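/- For real matrices $A\in\mathbb{R}^{m\times n}$ of full column rank $n$, let $\lambda(A)=\min_{x\in\mathbb{Z}^n\setminus\{0\}}\|Ax\|_2$ be the length of a shortest nonzero vector of the lattice $\{Ax : x\in\mathbb{Z}^n\}$. Hermite's constant is $$\gamma_n=\sup_{A}\frac{\lambda(A)^2}{\det(A^\top A)^{1/n}},$$ where the supremum is over all $m$ and all matrices $A\in\mathbb{R}^{m\times n}$ of full column rank $n$. Then for every integer $n\ge 1$ this supremum is finite and $$\gamma_n<\frac{n}{8.5}+2 .$$ -/

import Mathlib

/-- The first minimum `λ(A)` of the lattice `{A x : x ∈ ℤⁿ}` generated by the columns of `A`: the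
least Euclidean length of a vector `A x` with `x ∈ ℤⁿ`, `x ≠ 0`. When `A` has full column rank and
`n ≥ 1` the infimum is attained. -/
noncomputable def latticeMin {m n : ℕ} (A : Matrix (Fin m) (Fin n) ℝ) : ℝ :=
  sInf {r : ℝ | ∃ x : Fin n → ℤ, x ≠ 0 ∧
    r = ‖(WithLp.toLp 2 (A.mulVec fun i => (x i : ℝ)) : EuclideanSpace ℝ (Fin m))‖}

/-- The values `λ(A)² / det(Aᵀ A)^(1/n)`, where `A` runs over the real matrices with `n` columns,
any number `m` of rows, and full column rank. -/
def hermiteQuotients (n : ℕ) : Set ℝ :=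
  {r : ℝ | ∃ (m : ℕ) (A : Matrix (Fin m) (Fin n) ℝ), A.rank = n ∧
    r = latticeMin A ^ 2 / (A.transpose * A).det ^ (1 / (n : ℝ))}

/-- Hermite's constant `γ_n`: the supremum of `λ(A)² / det(Aᵀ A)^(1/n)` over all rank `n`
lattice bases. -/
noncomputable def hermiteConstant (n : ℕ) : ℝ := sSup (hermiteQuotients n)

/-! Blichfeldt's method. Put 2r = λ² and place the bump max(r - ‖u‖², 0) at every lattice point. The
bumps overlap, but their sum is nowhere above r (`sum_max_sub_norm_sq_le`), so integrating over a
fundamental domain bounds the mass of one bump by r times the covolume. This gives γ_n ≤ (2/π) Γ(n/2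
+ 2)^(2/n) (`hermiteQuotient_pow_le`), which is asymptotic to n/(πe). As πe ≈ 8.5397 exceeds 8.5, a
Stirling-type bound on Γ settles n ≥ 4; n ≤ 3 is checked directly. -/

/-! ### Overlapping paraboloids and their mass -/

theorem sum_max_sub_norm_sq_le {ι E : Type*} [NormedAddCommGroup E] [InnerProductSpace ℝ E]
    (s : Finset ι) (v : ι → E) {r : ℝ} (hr : 0 ≤ r)
    (hv : ∀ i j, i ≠ j → 2 * r ≤ ‖v i - v j‖ ^ 2) :
    ∑ i ∈ s, max (r - ‖v i‖ ^ 2) 0 ≤ r := by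
  classical
  set t := s.filter fun i => 0 < r - ‖v i‖ ^ 2
  have hsum : ∑ i ∈ s, max (r - ‖v i‖ ^ 2) 0 = ∑ i ∈ t, (r - ‖v i‖ ^ 2) := by
    rw [Finset.sum_filter]
    refine Finset.sum_congr rfl fun i _ => ?_
    split_ifs with h
    · exact max_eq_left h.le
    · exact max_eq_right (not_lt.mp h)
  rw [hsum]
  rcases t.eq_empty_or_nonempty with ht | ht
  · simpa [ht] using hr
  have hcard : (0 : ℝ) < t.card := by exact_mod_cast ht.card_pos
  have hexp : ∑ i ∈ t, ∑ j ∈ t, ‖v i - v j‖ ^ 2 =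
      2 * t.card * ∑ i ∈ t, ‖v i‖ ^ 2 - 2 * ‖∑ i ∈ t, v i‖ ^ 2 := by
    simp_rw [norm_sub_sq_real, Finset.sum_add_distrib, Finset.sum_sub_distrib, ← Finset.mul_sum,
      ← real_inner_self_eq_norm_sq (∑ i ∈ t, v i), sum_inner, inner_sum, Finset.sum_const,
      nsmul_eq_mul, ← Finset.mul_sum]
    ring
  have hlow : 2 * r * (t.card * (t.card - 1)) ≤ ∑ i ∈ t, ∑ j ∈ t, ‖v i - v j‖ ^ 2 := by
    have h : ∀ i ∈ t, 2 * r * (t.card - 1) ≤ ∑ j ∈ t, ‖v i - v j‖ ^ 2 := by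
      intro i hi
      calc 2 * r * ((t.card : ℝ) - 1) = ∑ j ∈ t, if i = j then 0 else 2 * r := by
            have h1 : ∀ j ∈ t, (if i = j then (0 : ℝ) else 2 * r) =
                2 * r - if i = j then 2 * r else 0 := by
              intro j _
              split_ifs <;> ring
            rw [Finset.sum_congr rfl h1, Finset.sum_sub_distrib, Finset.sum_ite_eq, if_pos hi]
            simp
            ring
        _ ≤ _ := by
            refine Finset.sum_le_sum fun j _ => ?_
            split_ifs with hij
            · positivity
            · exact hv i j hij
    calc _ = ∑ i ∈ t, 2 * r * ((t.card : ℝ) - 1) := by simp; ring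
      _ ≤ _ := Finset.sum_le_sum h
  -- Dropping ‖∑ v i‖² from `hexp` can only enlarge its right side.
  have hkey : (t.card : ℝ) * (r * (t.card - 1)) ≤ t.card * ∑ i ∈ t, ‖v i‖ ^ 2 := by
    nlinarith [sq_nonneg ‖∑ i ∈ t, v i‖]
  have := le_of_mul_le_mul_left hkey hcard
  simp only [Finset.sum_sub_distrib, Finset.sum_const, nsmul_eq_mul]
  linarith

-- Cut the integral into lattice translates of the fundamental domain; the pointwise bound applies
-- to the resulting sum because differences of distinct lattice vectors have squared norm at least
-- 2r.
open MeasureTheory in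
theorem lintegral_paraboloid_le_measure_fundamentalDomain {ι E : Type*} [Finite ι]
    [NormedAddCommGroup E] [InnerProductSpace ℝ E] [FiniteDimensional ℝ E]
    [MeasurableSpace E] [BorelSpace E] (μ : Measure E) [μ.IsAddHaarMeasure]
    (b : Module.Basis ι ℝ E) {r : ℝ} (hr : 0 ≤ r)
    (hb : ∀ x ∈ Submodule.span ℤ (Set.range b), x ≠ 0 → 2 * r ≤ ‖x‖ ^ 2) :
    ∫⁻ u, ENNReal.ofReal (max (r - ‖u‖ ^ 2) 0) ∂μ ≤
      ENNReal.ofReal r * μ (ZSpan.fundamentalDomain b) := by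
  have : VAddInvariantMeasure (Submodule.span ℤ (Set.range b)) E μ :=
    ⟨fun c s _ => measure_preimage_add μ (c : E) s⟩
  rw [(ZSpan.isAddFundamentalDomain b μ).lintegral_eq_tsum'', ← lintegral_tsum]
  · calc _ ≤ ∫⁻ _ in ZSpan.fundamentalDomain b, ENNReal.ofReal r ∂μ := by
          refine lintegral_mono fun x => ?_
          rw [ENNReal.tsum_eq_iSup_sum]
          refine iSup_le fun s => ?_
          rw [← ENNReal.ofReal_sum_of_nonneg fun _ _ => le_max_right _ _]
          refine ENNReal.ofReal_le_ofReal (sum_max_sub_norm_sq_le s (fun g => g +ᵥ x) hr ?_)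
          intro i j hij
          have h := hb (i - j : Submodule.span ℤ (Set.range b)) (Subtype.property _) (by
            simpa [sub_eq_zero] using hij)
          simpa [Submodule.vadd_def] using h
      _ = _ := by rw [setLIntegral_const]
  · intro g
    simp only [Submodule.vadd_def, vadd_eq_add]
    fun_prop

-- Layer cake: the superlevel set at height t is a ball of radius √(r - t).
open MeasureTheory in
theorem le_lintegral_paraboloid (n : ℕ) [NeZero n] {r : ℝ} (hr : 0 < r) :
    ENNReal.ofReal (r ^ ((n : ℝ) / 2 + 1) * (Real.pi ^ ((n : ℝ) / 2) / Real.Gamma ((n : ℝ) / 2 + 2)))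
      ≤ ∫⁻ u : EuclideanSpace ℝ (Fin n), ENNReal.ofReal (max (r - ‖u‖ ^ 2) 0) := by
  rw [lintegral_eq_lintegral_meas_lt (f := fun u : EuclideanSpace ℝ (Fin n) => max (r - ‖u‖ ^ 2) 0)
    _ (Filter.Eventually.of_forall fun _ => le_max_right _ _)
    (by fun_prop)]
  have hn : (0 : ℝ) ≤ (n : ℝ) / 2 := by positivity
  have hset : ∀ t ∈ Set.Ioc 0 r, volume {u : EuclideanSpace ℝ (Fin n) | t < max (r - ‖u‖ ^ 2) 0} =
      ENNReal.ofReal ((r - t) ^ ((n : ℝ) / 2) *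
        (Real.pi ^ ((n : ℝ) / 2) / Real.Gamma ((n : ℝ) / 2 + 1))) := by
    intro t ht
    have h1 : {u : EuclideanSpace ℝ (Fin n) | t < max (r - ‖u‖ ^ 2) 0} =
        Metric.ball 0 (√(r - t)) := by
      ext u
      simp only [Set.mem_ofPred_eq, lt_max_iff, not_lt.mpr ht.1.le, or_false, mem_ball_zero_iff]
      rw [Real.lt_sqrt (norm_nonneg _)]
      constructor <;> intro h <;> linarith
    have hs : ∀ x : ℝ, 0 ≤ x → √x ^ n = x ^ ((n : ℝ) / 2) := by
      intro x hx
      rw [Real.sqrt_eq_rpow, ← Real.rpow_mul_natCast hx]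
      congr 1
      ring
    rw [h1, EuclideanSpace.volume_ball, Fintype.card_fin, ← ENNReal.ofReal_pow (Real.sqrt_nonneg _),
      ← ENNReal.ofReal_mul (by positivity), hs _ (sub_nonneg.mpr ht.2), hs _ Real.pi_pos.le]
  set V := Real.pi ^ ((n : ℝ) / 2) / Real.Gamma ((n : ℝ) / 2 + 1) with hV
  have hV0 : 0 ≤ V := div_nonneg (by positivity) (Real.Gamma_pos_of_pos (by positivity)).le
  have hcont : Continuous fun t : ℝ => (r - t) ^ ((n : ℝ) / 2) * V :=
    ((continuous_const.sub continuous_id).rpow_const fun _ => Or.inr hn).mul continuous_const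
  calc _ = ENNReal.ofReal (∫ t in Set.Ioc 0 r, (r - t) ^ ((n : ℝ) / 2) * V) := by
        congr 1
        rw [← intervalIntegral.integral_of_le hr.le, intervalIntegral.integral_mul_const,
          intervalIntegral.integral_comp_sub_left (fun x => x ^ ((n : ℝ) / 2)), sub_self, sub_zero,
          integral_rpow (Or.inl (by linarith)), Real.zero_rpow (by linarith), hV,
          show (n : ℝ) / 2 + 2 = ((n : ℝ) / 2 + 1) + 1 by ring,
          Real.Gamma_add_one (by positivity)]
        have := (Real.Gamma_pos_of_pos (show 0 < (n : ℝ) / 2 + 1 by positivity)).ne'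
        field_simp
        ring
    _ = ∫⁻ t in Set.Ioc 0 r, ENNReal.ofReal ((r - t) ^ ((n : ℝ) / 2) * V) := by
        refine ofReal_integral_eq_lintegral_ofReal ?_ ?_
        · exact hcont.integrableOn_Ioc
        · refine (ae_restrict_mem measurableSet_Ioc).mono fun t ht => ?_
          exact mul_nonneg (Real.rpow_nonneg (sub_nonneg.mpr ht.2) _) hV0
    _ = ∫⁻ t in Set.Ioc 0 r, volume {u : EuclideanSpace ℝ (Fin n) | t < max (r - ‖u‖ ^ 2) 0} :=
        (setLIntegral_congr_fun measurableSet_Ioc hset).symm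
    _ ≤ _ := lintegral_mono_set Set.Ioc_subset_Ioi_self

/-! ### Blichfeldt's bound for Hermite's constant -/

theorem Matrix.isUnit_of_rank_eq {n : ℕ} {K : Type*} [Field K] {G : Matrix (Fin n) (Fin n) K}
    (h : G.rank = n) : IsUnit G := by
  rw [← Matrix.mulVec_surjective_iff_isUnit]
  have : LinearMap.range G.mulVecLin = ⊤ :=
    Submodule.eq_top_of_finrank_eq (by simpa [Matrix.rank] using h)
  exact LinearMap.range_eq_top.mp this

-- Reduces to full-dimensional lattices: lengths and determinant depend on `A` only through its Gram
-- matrix.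
open scoped MatrixOrder Matrix.Norms.L2Operator in
theorem Matrix.exists_square_transpose_mul_self_eq {m n : ℕ} (A : Matrix (Fin m) (Fin n) ℝ) :
    ∃ B : Matrix (Fin n) (Fin n) ℝ, A.transpose * A = B.transpose * B := by
  have h : (0 : Matrix (Fin n) (Fin n) ℝ) ≤ A.conjTranspose * A :=
    (Matrix.posSemidef_conjTranspose_mul_self A).nonneg
  obtain ⟨B, hB⟩ := CStarAlgebra.nonneg_iff_eq_star_mul_self.mp h
  exact ⟨B, by simpa [Matrix.star_eq_conjTranspose, Matrix.conjTranspose_eq_transpose_of_trivial]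
    using hB⟩

theorem Matrix.norm_toLp_mulVec_sq {m n : ℕ} (A : Matrix (Fin m) (Fin n) ℝ) (v : Fin n → ℝ) :
    ‖(WithLp.toLp 2 (A.mulVec v) : EuclideanSpace ℝ (Fin m))‖ ^ 2 =
      v ⬝ᵥ ((A.transpose * A).mulVec v) := by
  rw [EuclideanSpace.real_norm_sq_eq, ← Matrix.mulVec_mulVec, Matrix.dotProduct_mulVec,
    Matrix.vecMul_transpose]
  simp [dotProduct, sq]

theorem latticeMin_nonneg {m n : ℕ} (A : Matrix (Fin m) (Fin n) ℝ) : 0 ≤ latticeMin A := by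
  refine Real.sInf_nonneg ?_
  rintro _ ⟨x, -, rfl⟩
  exact norm_nonneg _

theorem latticeMin_le {m n : ℕ} (A : Matrix (Fin m) (Fin n) ℝ) {x : Fin n → ℤ} (hx : x ≠ 0) :
    latticeMin A ≤
      ‖(WithLp.toLp 2 (A.mulVec fun i => (x i : ℝ)) : EuclideanSpace ℝ (Fin m))‖ := by
  refine csInf_le ⟨0, ?_⟩ ⟨x, hx, rfl⟩
  rintro _ ⟨x, -, rfl⟩
  exact norm_nonneg _

theorem OrthonormalBasis.volume_fundamentalDomain {ι F : Type*} [Fintype ι]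
    [NormedAddCommGroup F] [InnerProductSpace ℝ F] [FiniteDimensional ℝ F] [MeasurableSpace F]
    [BorelSpace F] (b : OrthonormalBasis ι ℝ F) :
    MeasureTheory.volume (ZSpan.fundamentalDomain b.toBasis) = 1 := by
  rw [MeasureTheory.measure_congr (ZSpan.fundamentalDomain_ae_parallelepiped b.toBasis _),
    b.coe_toBasis, b.volume_parallelepiped]

/-- Blichfeldt's inequality for the lattice generated by the columns of a square matrix `B`. -/
theorem blichfeldt_le_abs_det {n : ℕ} [NeZero n] (B : Matrix (Fin n) (Fin n) ℝ) (hB : B.det ≠ 0)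
    {r : ℝ} (hr : 0 < r)
    (h : ∀ x : Fin n → ℤ, x ≠ 0 → 2 * r ≤
      ‖(WithLp.toLp 2 (B.mulVec fun i => (x i : ℝ)) : EuclideanSpace ℝ (Fin n))‖ ^ 2) :
    r ^ ((n : ℝ) / 2) * (Real.pi ^ ((n : ℝ) / 2) / Real.Gamma ((n : ℝ) / 2 + 2)) ≤ |B.det| := by
  set e := (EuclideanSpace.basisFun (Fin n) ℝ).toBasis with he
  set f : EuclideanSpace ℝ (Fin n) →ₗ[ℝ] EuclideanSpace ℝ (Fin n) := Matrix.toLin e e B with hf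
  have hdet : LinearMap.det f = B.det := LinearMap.det_toLin e B
  have hdet0 : LinearMap.det f ≠ 0 := hdet ▸ hB
  set b := e.map (f.equivOfDetNeZero hdet0) with hb
  have hbf : ⇑b = ⇑f ∘ ⇑e := by
    ext1 i
    simp [hb, LinearMap.equivOfDetNeZero]
  have hfx : ∀ v : Fin n → ℝ, f (WithLp.toLp 2 v) = WithLp.toLp 2 (B.mulVec v) := by
    intro v
    rw [hf, he, ← Matrix.toEuclideanLin_eq_toLin_orthonormal]
    rfl
  have hmin : ∀ x ∈ Submodule.span ℤ (Set.range b), x ≠ 0 → 2 * r ≤ ‖x‖ ^ 2 := by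
    intro x hx hx0
    obtain ⟨c, rfl⟩ := (Submodule.mem_span_range_iff_exists_fun ℤ).mp hx
    have hc : ∑ i, c i • b i = WithLp.toLp 2 (B.mulVec fun i => (c i : ℝ)) := by
      rw [← hfx, hbf]
      simp only [Function.comp_apply, ← map_zsmul, ← map_sum]
      congr 1
      ext j
      simp [he, Finset.sum_apply, Pi.single_apply]
    rw [hc]
    refine h c ?_
    rintro rfl
    simp at hx0
  have hvol : MeasureTheory.volume (ZSpan.fundamentalDomain b) = ENNReal.ofReal |B.det| := by
    rw [ZSpan.measure_fundamentalDomain b _ e, OrthonormalBasis.volume_fundamentalDomain, mul_one,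
      hbf, Module.Basis.det_comp_basis]
    simp [hdet]
  have := (le_lintegral_paraboloid n hr).trans
    (lintegral_paraboloid_le_measure_fundamentalDomain MeasureTheory.volume b hr.le hmin)
  rw [hvol, ← ENNReal.ofReal_mul hr.le, ENNReal.ofReal_le_ofReal_iff (by positivity),
    Real.rpow_add_one hr.ne', mul_comm _ r, mul_assoc] at this
  exact le_of_mul_le_mul_left this hr

theorem hermiteQuotient_pow_le {n : ℕ} [NeZero n] {q : ℝ} (hq : q ∈ hermiteQuotients n) :
    0 ≤ q ∧ (q * (Real.pi / 2)) ^ n ≤ Real.Gamma ((n : ℝ) / 2 + 2) ^ 2 := by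
  obtain ⟨m, A, hA, rfl⟩ := hq
  obtain ⟨B, hB⟩ := A.exists_square_transpose_mul_self_eq
  have hu : IsUnit (A.transpose * A) :=
    Matrix.isUnit_of_rank_eq (by rw [Matrix.rank_transpose_mul_self, hA])
  have hD : (A.transpose * A).det = B.det ^ 2 := by
    rw [hB, Matrix.det_mul, Matrix.det_transpose, sq]
  have hB0 : B.det ≠ 0 := by
    intro h0
    have := ((Matrix.isUnit_iff_isUnit_det _).mp hu).ne_zero
    rw [hD, h0] at this
    simp at this
  have hD0 : 0 < B.det ^ 2 := by positivity
  have hn0 : n ≠ 0 := NeZero.ne n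
  rw [hD]
  refine ⟨by positivity, ?_⟩
  have hpow : ((B.det ^ 2) ^ (1 / (n : ℝ))) ^ n = B.det ^ 2 := by
    rw [one_div, Real.rpow_inv_natCast_pow hD0.le hn0]
  rw [mul_pow, div_pow, hpow]
  have hG := Real.Gamma_pos_of_pos (show 0 < (n : ℝ) / 2 + 2 by positivity)
  -- The bound is trivial when λ = 0, so attainment of the infimum is never needed.
  rcases (latticeMin_nonneg A).eq_or_lt with h0 | h0
  · rw [← h0, zero_pow two_ne_zero, zero_pow hn0]
    simp only [zero_div, zero_mul]
    positivity
  have hsq : ∀ x : ℝ, 0 ≤ x → (x ^ ((n : ℝ) / 2)) ^ 2 = x ^ n := by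
    intro x hx
    rw [← Real.rpow_natCast, ← Real.rpow_mul hx, ← Real.rpow_natCast]
    congr 1
    push_cast
    ring
  have hkey := blichfeldt_le_abs_det B hB0 (r := latticeMin A ^ 2 / 2) (by positivity) fun x hx => by
    rw [Matrix.norm_toLp_mulVec_sq, ← hB, ← Matrix.norm_toLp_mulVec_sq,
      mul_div_cancel₀ _ two_ne_zero]
    exact pow_le_pow_left₀ h0.le (latticeMin_le A hx) 2
  have := pow_le_pow_left₀ (by positivity) hkey 2
  rw [sq_abs, mul_pow, div_pow, hsq _ (by positivity), hsq _ Real.pi_pos.le, ← mul_div_assoc,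
    div_le_iff₀ (by positivity), div_pow] at this
  rw [div_pow, div_mul_eq_mul_div, div_le_iff₀ hD0]
  calc _ = (latticeMin A ^ 2) ^ n / 2 ^ n * Real.pi ^ n := by ring
    _ ≤ _ := this
    _ = _ := by ring

theorem bddAbove_and_hermiteConstant_lt {n : ℕ} [NeZero n] {c : ℝ} (hc : 0 < c)
    (h : Real.Gamma ((n : ℝ) / 2 + 2) ^ 2 < (c * (Real.pi / 2)) ^ n) :
    BddAbove (hermiteQuotients n) ∧ hermiteConstant n < c := by
  have hn0 : n ≠ 0 := NeZero.ne n
  have hpi := Real.pi_pos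
  set C := (Real.Gamma ((n : ℝ) / 2 + 2) ^ 2) ^ ((n : ℝ)⁻¹) with hC
  have hC0 : 0 ≤ C := by positivity
  have hCn : C ^ n = Real.Gamma ((n : ℝ) / 2 + 2) ^ 2 :=
    Real.rpow_inv_natCast_pow (by positivity) hn0
  have hle : ∀ q ∈ hermiteQuotients n, q ≤ C / (Real.pi / 2) := by
    intro q hq
    obtain ⟨hq0, hq1⟩ := hermiteQuotient_pow_le hq
    rw [le_div_iff₀ (by positivity)]
    exact le_of_pow_le_pow_left₀ hn0 hC0 (hCn ▸ hq1)
  have hlt : C / (Real.pi / 2) < c := by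
    rw [div_lt_iff₀ (by positivity)]
    exact lt_of_pow_lt_pow_left₀ n (by positivity) (hCn ▸ h)
  exact ⟨⟨_, hle⟩, (Real.sSup_le hle (by positivity)).trans_lt hlt⟩

/-! ### Numerical estimates for Γ -/

theorem Real.log_le_log_add_div_sub_one {x a : ℝ} (hx : 0 < x) (ha : 0 < a) :
    Real.log x ≤ Real.log a + x / a - 1 := by
  have h := Real.log_le_sub_one_of_pos (div_pos hx ha)
  rw [Real.log_div hx.ne' ha.ne'] at h
  linarith

theorem Real.div_le_log_add_sub_log {x a : ℝ} (hx : 0 < x) (ha : 0 ≤ a) :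
    2 * a / (2 * x + a) ≤ Real.log (x + a) - Real.log x := by
  have h := Real.le_log_one_add_of_nonneg (div_nonneg ha hx.le)
  rw [← Real.log_div (by positivity) hx.ne']
  convert h using 1
  · field_simp
    ring
  · congr 1
    field_simp

/-- With x = n/2, the step n → n + 2 amounts to (x + 1/2) log(1 + 1/x) ≥ 1. The constant 1.08 is
dictated by n = 1, which needs (1 + log π)/2 ≈ 1.0724. -/
theorem log_Gamma_half_add_one_le (n : ℕ) (hn : 1 ≤ n) :
    Real.log (Real.Gamma ((n : ℝ) / 2 + 1)) ≤
      1.08 + ((n : ℝ) / 2 + 1 / 2) * Real.log ((n : ℝ) / 2) - (n : ℝ) / 2 := by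
  induction n using Nat.twoStepInduction with
  | zero => omega
  | one =>
    have hpi : Real.log Real.pi ≤ 1.16 := by
      have h := Real.log_le_log_add_div_sub_one Real.pi_pos (Real.exp_pos 1)
      have h2 : Real.pi / Real.exp 1 ≤ 1.16 := by
        rw [div_le_iff₀ (Real.exp_pos 1)]
        linarith [Real.pi_lt_d6, Real.exp_one_gt_d9]
      rw [Real.log_exp] at h
      linarith
    rw [Nat.cast_one, Real.Gamma_add_one (by norm_num), Real.Gamma_one_half_eq,
      Real.log_mul (by norm_num) (by positivity), Real.log_sqrt Real.pi_pos.le]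
    linarith
  | more n ih _ =>
    rcases Nat.eq_zero_or_pos n with rfl | hpos
    · norm_num
    have hx : (0 : ℝ) < (n : ℝ) / 2 := by positivity
    have hd := Real.div_le_log_add_sub_log hx zero_le_one
    rw [div_le_iff₀ (by positivity)] at hd
    have := ih hpos
    push_cast
    rw [show ((n : ℝ) + 2) / 2 = (n : ℝ) / 2 + 1 by ring, Real.Gamma_add_one (by positivity),
      Real.log_mul (by positivity) (Real.Gamma_pos_of_pos (by positivity)).ne']
    linarith

/-- What remains after Stirling, with x = n/2: 0.00464 is the slack in log(πe/8.5), and the fraction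
bounds x log(1 + 8.5/x) from below. On each range both logarithms are replaced by a tangent line at
a point `a`. -/
theorem log_add_log_lt_of_two_le {x : ℝ} (hx : 2 ≤ x) :
    1.08 + Real.log x / 2 + Real.log (x + 1) < 0.00464 * x + 17 * x / (2 * x + 8.5) := by
  have hx0 : 0 < x := by linarith
  have hl2 := Real.log_two_lt_d9
  have key : ∀ a : ℝ, 0 < a → (1.08 + (Real.log a + x / a - 1) / 2 +
      (Real.log a + (x + 1) / a - 1) - 0.00464 * x) * (2 * x + 8.5) < 17 * x →
      1.08 + Real.log x / 2 + Real.log (x + 1) < 0.00464 * x + 17 * x / (2 * x + 8.5) := by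
    intro a ha h
    rw [← lt_div_iff₀ (by positivity)] at h
    have h1 := Real.log_le_log_add_div_sub_one hx0 ha
    have h2 := Real.log_le_log_add_div_sub_one (by linarith : 0 < x + 1) ha
    linarith
  have key' : ∀ a l : ℝ, 0 < a → Real.log a ≤ l → (1.08 + (l + x / a - 1) / 2 +
      (l + (x + 1) / a - 1) - 0.00464 * x) * (2 * x + 8.5) < 17 * x →
      1.08 + Real.log x / 2 + Real.log (x + 1) < 0.00464 * x + 17 * x / (2 * x + 8.5) := by
    intro a l ha hl h
    refine key a ha (lt_of_le_of_lt ?_ h)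
    gcongr
  have hpow : ∀ k : ℕ, Real.log (2 ^ k) ≤ k * 0.69315 := by
    intro k
    rw [Real.log_pow]
    gcongr
    linarith
  rcases le_total x 8 with h8 | h8
  · refine key' (2 ^ 2) _ (by norm_num) (hpow 2) ?_
    norm_num
    nlinarith
  rcases le_total x 32 with h32 | h32
  · refine key' (2 ^ 4) _ (by norm_num) (hpow 4) ?_
    norm_num
    nlinarith
  rcases le_total x 100 with h100 | h100
  · refine key' (2 ^ 6) _ (by norm_num) (hpow 6) ?_
    norm_num
    nlinarith
  rcases le_total x 190 with h190 | h190
  · refine key' (2 ^ 7) _ (by norm_num) (hpow 7) ?_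
    norm_num
    nlinarith
  · have h5 : Real.log 5 ≤ 1.61735 := by
      have h : Real.log (5 ^ 3) ≤ Real.log (2 ^ 7) := Real.log_le_log (by norm_num) (by norm_num)
      rw [Real.log_pow, Real.log_pow] at h
      push_cast at h
      linarith
    have h320 : Real.log 320 ≤ 5.77625 := by
      rw [show (320 : ℝ) = 2 ^ 6 * 5 by norm_num, Real.log_mul (by norm_num) (by norm_num)]
      have := hpow 6
      norm_num at this ⊢
      linarith
    have h325 : Real.log 325 ≤ 5.7919 := by
      have := Real.log_le_log_add_div_sub_one (show (0 : ℝ) < 325 by norm_num)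
        (show (0 : ℝ) < 320 by norm_num)
      norm_num at this h320 ⊢
      linarith
    -- On this unbounded range the tangent slope must stay below 0.00464; 1.5/325 does, 1.5/320 does
    -- not.
    refine key' 325 _ (by norm_num) h325 ?_
    norm_num
    nlinarith

theorem log_pi_gt : Real.log 8.5 - 1 + 0.00464 < Real.log Real.pi := by
  have h : 8.5 * (1 + 0.00466) ≤ Real.pi * Real.exp 1 := by
    nlinarith [Real.pi_gt_d6, Real.exp_one_gt_d9]
  have h1 := Real.log_le_log (by norm_num) h
  rw [Real.log_mul (by norm_num) (by norm_num), Real.log_mul Real.pi_pos.ne' (Real.exp_pos 1).ne',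
    Real.log_exp] at h1
  have h2 := Real.le_log_one_add_of_nonneg (show (0 : ℝ) ≤ 0.00466 by norm_num)
  norm_num at h1 h2 ⊢
  linarith

theorem Gamma_half_add_two_sq_lt (n : ℕ) (hn : 1 ≤ n) :
    Real.Gamma ((n : ℝ) / 2 + 2) ^ 2 < (((n : ℝ) / 8.5 + 2) * (Real.pi / 2)) ^ n := by
  have hpi := Real.pi_gt_d6
  have hpi' := Real.pi_lt_d6
  have hG (x : ℝ) (hx : 0 < x) : Real.Gamma (x + 2) = (x + 1) * (x * Real.Gamma x) := by
    rw [show x + 2 = x + 1 + 1 by ring, Real.Gamma_add_one (by positivity),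
      Real.Gamma_add_one hx.ne']
  have hhalf : Real.Gamma (3 / 2) = 1 / 2 * √Real.pi := by
    rw [show (3 / 2 : ℝ) = 1 / 2 + 1 by norm_num, Real.Gamma_add_one (by norm_num),
      Real.Gamma_one_half_eq]
  rcases lt_or_ge n 4 with h4 | h4
  · interval_cases n
    · rw [hG _ (by norm_num), Nat.cast_one, Real.Gamma_one_half_eq, mul_pow, mul_pow,
        Real.sq_sqrt Real.pi_pos.le]
      norm_num
      linarith
    · rw [hG _ (by norm_num)]
      norm_num
      nlinarith
    · rw [hG _ (by norm_num), Nat.cast_ofNat, hhalf, mul_pow, mul_pow, mul_pow,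
        Real.sq_sqrt Real.pi_pos.le]
      have h3 : (3 : ℝ) ^ 3 ≤ ((3 / 8.5 + 2) * (Real.pi / 2)) ^ 3 := by
        gcongr
        norm_num
        linarith
      norm_num at h3 ⊢
      linarith
  · have hn4 : (4 : ℝ) ≤ n := by exact_mod_cast h4
    set x := (n : ℝ) / 2 with hx
    have hx2 : 2 ≤ x := by linarith
    have hGpos : 0 < Real.Gamma (x + 2) := Real.Gamma_pos_of_pos (by linarith)
    rw [← Real.log_lt_log_iff (by positivity) (by positivity), Real.log_pow, Real.log_pow,
      show ((n : ℝ) / 8.5 + 2) * (Real.pi / 2) = Real.pi * ((x + 8.5) / 8.5) by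
        rw [hx]; ring, Real.log_mul (by positivity) (by positivity),
      Real.log_div (by positivity) (by norm_num), show x + 2 = x + 1 + 1 by ring,
      Real.Gamma_add_one (by positivity), Real.log_mul (by positivity)
        (Real.Gamma_pos_of_pos (by positivity)).ne', show (n : ℝ) = 2 * x by rw [hx]; ring]
    have h1 := log_Gamma_half_add_one_le n hn
    rw [← hx] at h1
    have h2 := log_add_log_lt_of_two_le hx2
    have h3 := Real.div_le_log_add_sub_log (show 0 < x by linarith) (show (0 : ℝ) ≤ 8.5 by norm_num)
    have h4 : x * (Real.log x - 1 + 0.00464 + 2 * 8.5 / (2 * x + 8.5)) ≤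
        x * (Real.log Real.pi + (Real.log (x + 8.5) - Real.log 8.5)) := by
      refine mul_le_mul_of_nonneg_left ?_ (by linarith)
      linarith [log_pi_gt]
    have h5 : x * (2 * 8.5 / (2 * x + 8.5)) = 17 * x / (2 * x + 8.5) := by ring
    push_cast
    linarith

theorem theorem1 (n : ℕ) (hn : 1 ≤ n) :
    BddAbove (hermiteQuotients n) ∧ hermiteConstant n < (n : ℝ) / 8.5 + 2 := by
  have : NeZero n := ⟨by omega⟩
  exact bddAbove_and_hermiteConstant_lt (by positivity) (Gamma_half_add_two_sq_lt n hn)
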